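/- Let $\mathbb F$ be an arbitrary field and $V$ a finite-dimensional $\mathbb F$-vector space of dimension $n$. Let $H\le V$ be a hyperplane, and let $l_H\in V^*$ be a linear form with $\ker l_H=H$. Let $G\le \mathrm{GL}(V)$ be a finite group that fixes $H$ pointwise. Fix a basis $z_1,\dots,z_n$ of $V^*$, so that $\mathbb F[V]=\mathrm{Sym}(V^*)=\mathbb F[z_1,\dots,z_n]$, and let $G$ act on $\mathbb F[V]$ by algebra automorphisms extending its action $g\cdot\xi=\xi\circ g^{-1}$ on $V^*$. Then: (a) $G$ has a polynomial ring of invariants: there are homogeneous, algebraically independent polynomials $f_1,\dots,f_n\in\mathbb F[V]$ (called *basic invariants* of $G$) such that $\mathbb F[V]^G=\mathbb F[f_1,\dots,f_n]$. (b) For every choice of basic invariants $f_1,\dots,f_n$ of $G$ there is a nonzero $c\in\mathbb F$ such that $$\det\left(\frac{\partial f_i}{\partial z_j}\right)_{i,j=1}^n = c\, l_H^{\,m},\qquad m=\sum_{i=1}^n(\deg f_i-1),$$ that is, $m$ is the sum of the exponents $\deg f_i-1$ of $G$. -/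

import Mathlib

namespace HyperplaneInvariants

/-- The element of the polynomial ring `F[V] = F[z₁, …, zₙ]` given by a linear form `ξ ∈ V*`,
where `z₁, …, zₙ` is a basis of `V*` and `z j` is identified with the variable `X j`. -/
noncomputable def linForm {F V : Type*} [Field F] [AddCommGroup V] [Module F V] {n : ℕ}
    (z : Module.Basis (Fin n) F (Module.Dual F V)) (ξ : Module.Dual F V) :
    MvPolynomial (Fin n) F :=
  ∑ j, MvPolynomial.C (z.repr ξ j) * MvPolynomial.X j

/-- The action of `g ∈ GL(V)` on `F[V] = F[z₁, …, zₙ]`: the `F`-algebra homomorphism which extends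
the action `ξ ↦ ξ ∘ g⁻¹` on `V*`. -/
noncomputable def act {F V : Type*} [Field F] [AddCommGroup V] [Module F V] {n : ℕ}
    (z : Module.Basis (Fin n) F (Module.Dual F V)) (g : LinearMap.GeneralLinearGroup F V) :
    MvPolynomial (Fin n) F →ₐ[F] MvPolynomial (Fin n) F :=
  MvPolynomial.aeval fun j =>
    linForm z ((z j).comp ((g⁻¹ : LinearMap.GeneralLinearGroup F V) : V →ₗ[F] V))

/-- The ring of invariants `F[V]^G`, a subalgebra of `F[V] = F[z₁, …, zₙ]`. -/
noncomputable def invariants {F V : Type*} [Field F] [AddCommGroup V] [Module F V] {n : ℕ}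
    (z : Module.Basis (Fin n) F (Module.Dual F V))
    (G : Subgroup (LinearMap.GeneralLinearGroup F V)) :
    Subalgebra F (MvPolynomial (Fin n) F) where
  carrier := {f | ∀ g ∈ G, act z g f = f}
  mul_mem' := fun ha hb g hg => by rw [map_mul, ha g hg, hb g hg]
  add_mem' := fun ha hb g hg => by rw [map_add, ha g hg, hb g hg]
  algebraMap_mem' := fun c g _ => (act z g).commutes c

/-- `f₁, …, fₙ` are basic invariants of `G`: homogeneous, algebraically independent polynomials
with `F[V]^G = F[f₁, …, fₙ]`. -/
structure IsBasicInvariants {F V : Type*} [Field F] [AddCommGroup V] [Module F V] {n : ℕ}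
    (z : Module.Basis (Fin n) F (Module.Dual F V))
    (G : Subgroup (LinearMap.GeneralLinearGroup F V))
    (f : Fin n → MvPolynomial (Fin n) F) : Prop where
  homogeneous : ∀ i, ∃ d : ℕ, (f i).IsHomogeneous d
  algebraicIndependent : AlgebraicIndependent F f
  adjoin_eq : Algebra.adjoin F (Set.range f) = invariants z G

/-- `G` has a polynomial ring of invariants. -/
def HasPolynomialInvariants {F V : Type*} [Field F] [AddCommGroup V] [Module F V] {n : ℕ}
    (z : Module.Basis (Fin n) F (Module.Dual F V))
    (G : Subgroup (LinearMap.GeneralLinearGroup F V)) : Prop :=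
  ∃ f : Fin n → MvPolynomial (Fin n) F, IsBasicInvariants z G f

/-- The Jacobian determinant `det (∂fᵢ/∂zⱼ)`. -/
noncomputable def jacobian {F : Type*} [Field F] {n : ℕ}
    (f : Fin n → MvPolynomial (Fin n) F) : MvPolynomial (Fin n) F :=
  (Matrix.of fun i j => MvPolynomial.pderiv j (f i)).det

/-- The sum `∑ (deg fᵢ - 1)` of the exponents. The natural-number subtraction is harmless, since
algebraically independent polynomials have positive degree. -/
noncomputable def exponentSum {F : Type*} [Field F] {n : ℕ}
    (f : Fin n → MvPolynomial (Fin n) F) : ℕ :=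
  ∑ i, ((f i).totalDegree - 1)

end HyperplaneInvariants

/-! Each `g ∈ G` changes every `z j` by a multiple of `L`, the polynomial of `l`. Hence `L` is an
eigenvector with a character `χ`, whose finite image in `Fˣ` is cyclic, generated by some `ζ = χ s`.
There are linear coordinates of which one is `L` and the others are fixed by `s`.

The elements of `ker χ` act by translations and are adjoined one at a time, together with their
conjugates under powers of `s`. The invariant of this process is `IsAdapted`: homogeneous
coordinates `y i` of degree `d i`, which `ker χ` translates by multiples of `L ^ d i`. Given a new
`h`, take a moved `y i` of least degree; a shear makes it the only moved coordinate, with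
translation `c * L ^ d i`. The conjugates of `h` translate it by `ζ ^ k * c * L ^ d i`, and the
powers of `ζ` span additively the field `𝔽_p(ζ)` of `q` elements. So `y i` is replaced by `y i ^ q -
(c * L ^ d i) ^ (q - 1) * y i` (`IsAdapted.orbitStep`). At the end `L` is replaced by `L ^ e`, where
`e` is the order of `ζ`.

By the chain rule each replacement multiplies the Jacobian by a nonzero constant times a power of
`L`. Any other system of basic invariants has the same Jacobian up to a unit, and the exponent is
found by comparing degrees. -/

open MvPolynomial

namespace HyperplaneInvariants

/-! ### Univariate invariants of translations and scalings -/

/-- A polynomial invariant under `q` distinct translations, which also fix a monic polynomial `N`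
of degree `q`, is a polynomial in `N`. -/
theorem exists_eq_comp_of_translation_invariant {A : Type*} [CommRing A] [IsDomain A]
    (Q : Finset A) (hQ : 0 < Q.card) (N : Polynomial A) (hN : N.Monic)
    (hdeg : N.natDegree = Q.card)
    (hinv : ∀ a ∈ Q, N.comp (Polynomial.X + Polynomial.C a) = N) (f : Polynomial A)
    (hf : ∀ a ∈ Q, f.comp (Polynomial.X + Polynomial.C a) = f) :
    ∃ g : Polynomial A, f = g.comp N := by
  induction hd : f.natDegree using Nat.strong_induction_on generalizing f with
  | _ k ih =>
    have hN1 : N ≠ 1 := by rintro rfl; simp at hdeg; omega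
    -- Uniqueness of division with remainder makes both the quotient and the remainder invariant.
    have key : ∀ a ∈ Q, (f /ₘ N).comp (Polynomial.X + Polynomial.C a) = f /ₘ N ∧
        (f %ₘ N).comp (Polynomial.X + Polynomial.C a) = f %ₘ N := by
      intro a ha
      have h := Polynomial.div_modByMonic_unique (f := f)
        ((f /ₘ N).comp (Polynomial.X + Polynomial.C a))
        ((f %ₘ N).comp (Polynomial.X + Polynomial.C a)) hN ⟨by
          conv_rhs => rw [← hf a ha, ← Polynomial.modByMonic_add_div f N]
          rw [Polynomial.add_comp, Polynomial.mul_comp, hinv a ha], by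
          have h1 : ((f %ₘ N).comp (Polynomial.X + Polynomial.C a)).natDegree < N.natDegree := by
            rw [Polynomial.natDegree_comp, Polynomial.natDegree_X_add_C, mul_one]
            exact Polynomial.natDegree_modByMonic_lt f hN hN1
          exact Polynomial.degree_lt_degree h1⟩
      exact ⟨h.1.symm, h.2.symm⟩
    -- The invariant remainder takes its value at `0` at all `q` points of `Q`, and its degree is
    -- less than `q`.
    have hr : f %ₘ N = Polynomial.C ((f %ₘ N).eval 0) := by
      apply Polynomial.eq_of_degree_sub_lt_of_eval_finset_eq Q
      · rw [← hdeg, ← Polynomial.degree_eq_natDegree hN.ne_zero]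
        refine lt_of_le_of_lt (Polynomial.degree_sub_le _ _) (max_lt
          (Polynomial.degree_modByMonic_lt f hN) (lt_of_le_of_lt Polynomial.degree_C_le ?_))
        rw [Polynomial.degree_eq_natDegree hN.ne_zero]
        exact_mod_cast hdeg ▸ hQ
      · intro a ha
        conv_rhs => rw [← (key a ha).2]
        simp
    by_cases hk : k = 0
    · refine ⟨f, ?_⟩
      rw [Polynomial.eq_C_of_natDegree_eq_zero (hd.trans hk), Polynomial.C_comp]
    · obtain ⟨g, hg⟩ := ih (f /ₘ N).natDegree (by
        rw [Polynomial.natDegree_divByMonic f hN]; omega) (f /ₘ N) (fun a ha => (key a ha).1) rfl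
      refine ⟨Polynomial.C ((f %ₘ N).eval 0) + Polynomial.X * g, ?_⟩
      conv_lhs => rw [← Polynomial.modByMonic_add_div f N]
      rw [Polynomial.add_comp, Polynomial.C_comp, Polynomial.mul_comp, Polynomial.X_comp, ← hr,
        ← hg]

/-- A polynomial invariant under scaling by a root of unity of order `e` is a polynomial
in `X ^ e`. -/
theorem exists_eq_comp_of_scaling_invariant {A : Type*} [CommRing A] [IsDomain A]
    (ζ : A) (f : Polynomial A)
    (hf : f.comp (Polynomial.C ζ * Polynomial.X) = f) (he : orderOf ζ ≠ 0) :
    ∃ g : Polynomial A, f = g.comp (Polynomial.X ^ orderOf ζ) := by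
  refine ⟨f.contract (orderOf ζ), ?_⟩
  rw [← Polynomial.expand_eq_comp_X_pow]
  ext k
  rw [Polynomial.coeff_expand (Nat.pos_of_ne_zero he)]
  split_ifs with h
  · rw [Polynomial.coeff_contract he, Nat.div_mul_cancel h]
  · have h1 : f.coeff k * ζ ^ k = f.coeff k := by
      conv_rhs => rw [← hf]
      rw [Polynomial.comp_C_mul_X_coeff]
    by_contra h2
    exact h (orderOf_dvd_of_pow_eq_one (mul_left_cancel₀ h2 (h1.trans (mul_one _).symm)))

/-! ### Singling out one variable -/

section Pivot

variable {F : Type*} [Field F] {σ : Type*} [DecidableEq σ]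

/-- View a multivariate polynomial as a univariate polynomial in the variable `i`. -/
noncomputable def toPivot (F : Type*) [Field F] (i : σ) :
    MvPolynomial σ F →ₐ[F] Polynomial (MvPolynomial {j // j ≠ i} F) :=
  aeval fun j => if h : j = i then Polynomial.X else Polynomial.C (X ⟨j, h⟩)

/-- The inverse of `toPivot`. -/
noncomputable def ofPivot (F : Type*) [Field F] (i : σ) :
    Polynomial (MvPolynomial {j // j ≠ i} F) →+* MvPolynomial σ F :=
  Polynomial.eval₂RingHom (rename Subtype.val).toRingHom (X i)

@[simp] theorem toPivot_X_self (i : σ) : toPivot F i (X i) = Polynomial.X := by simp [toPivot]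

theorem toPivot_X_of_ne {i j : σ} (h : j ≠ i) :
    toPivot F i (X j) = Polynomial.C (X ⟨j, h⟩) := by simp [toPivot, h]

@[simp] theorem toPivot_C (i : σ) (c : F) :
    toPivot F i (C c) = Polynomial.C (C c) := by
  rw [toPivot, aeval_C]; rfl

theorem ofPivot_toPivot (i : σ) (f : MvPolynomial σ F) : ofPivot F i (toPivot F i f) = f := by
  induction f using MvPolynomial.induction_on with
  | C a => simp [ofPivot]
  | add p q hp hq => rw [map_add, map_add, hp, hq]
  | mul_X p j hp =>
    rw [map_mul, map_mul, hp]
    by_cases h : j = i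
    · subst h; simp [ofPivot]
    · simp [toPivot_X_of_ne h, ofPivot]

theorem toPivot_injective (i : σ) : Function.Injective (toPivot F i) :=
  Function.LeftInverse.injective (ofPivot_toPivot i)

/-- Turns substitution for one variable into composition of univariate polynomials, so that the two
univariate lemmas apply. -/
theorem toPivot_aeval_update (i : σ) (N f : MvPolynomial σ F) :
    toPivot F i (aeval (Function.update X i N) f) = (toPivot F i f).comp (toPivot F i N) := by
  induction f using MvPolynomial.induction_on with
  | C a => simp
  | add p q hp hq => simp only [map_add, hp, hq, Polynomial.add_comp]
  | mul_X p j hp =>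
    rw [map_mul, map_mul, hp, map_mul, Polynomial.mul_comp]
    by_cases h : j = i
    · subst h; simp
    · simp [toPivot_X_of_ne h, h]

theorem ofPivot_comp (i : σ) (N : MvPolynomial σ F)
    (g : Polynomial (MvPolynomial {j // j ≠ i} F)) :
    ofPivot F i (g.comp (toPivot F i N)) = aeval (Function.update X i N) (ofPivot F i g) := by
  induction g using Polynomial.induction_on' with
  | add p q hp hq => simp only [map_add, hp, hq, Polynomial.add_comp]
  | monomial k a =>
    have : rename Subtype.val a =
        aeval (Function.update X i N) (rename (Subtype.val : {j // j ≠ i} → σ) a) := by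
      rw [aeval_rename, rename_eq_aeval]
      congr 2
      funext j
      simp [j.2]
    rw [← Polynomial.C_mul_X_pow_eq_monomial, Polynomial.mul_comp, Polynomial.C_comp,
      Polynomial.X_pow_comp, map_mul, map_pow, ofPivot_toPivot, map_mul, map_pow]
    simp only [ofPivot, Polynomial.coe_eval₂RingHom, Polynomial.eval₂_C, Polynomial.eval₂_X,
      map_mul, map_pow, aeval_X, Function.update_self]
    exact congrArg (· * N ^ k) this

theorem mem_range_aeval_update {i : σ} {N f : MvPolynomial σ F}
    (h : ∃ g : Polynomial (MvPolynomial {j // j ≠ i} F),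
      toPivot F i f = g.comp (toPivot F i N)) :
    f ∈ (aeval (R := F) (Function.update (X : σ → MvPolynomial σ F) i N)).range := by
  obtain ⟨g, hg⟩ := h
  exact ⟨ofPivot F i g, by
    rw [← ofPivot_toPivot i f, hg, ofPivot_comp]; rfl⟩

theorem aeval_update_injective {i : σ} {N : MvPolynomial σ F}
    (hN : (toPivot F i N).natDegree ≠ 0) :
    Function.Injective (aeval (R := F) (Function.update (X : σ → MvPolynomial σ F) i N)) := by
  rw [injective_iff_map_eq_zero]
  intro f hf
  have h := toPivot_aeval_update i N f
  rw [hf, map_zero, eq_comm, Polynomial.comp_eq_zero_iff] at h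
  rcases h with h | ⟨-, h⟩
  · exact toPivot_injective i (h.trans (map_zero _).symm)
  · exact absurd (by rw [h, Polynomial.natDegree_C]) hN

end Pivot

/-! ### Chain rule and Jacobians -/

section Jacobian

variable {F : Type*} [Field F] {n : ℕ}

theorem pderiv_aeval (y : Fin n → MvPolynomial (Fin n) F) (j : Fin n)
    (p : MvPolynomial (Fin n) F) :
    pderiv j (aeval y p) = ∑ k, aeval y (pderiv k p) * pderiv j (y k) := by
  induction p using MvPolynomial.induction_on with
  | C a => simp [algebraMap_eq]
  | add p q hp hq => simp only [map_add, hp, hq, add_mul, Finset.sum_add_distrib]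
  | mul_X p i hp =>
    rw [map_mul, pderiv_mul, hp, aeval_X, Finset.sum_mul]
    have : ∀ k, aeval y (pderiv k (p * X i)) * pderiv j (y k) =
        aeval y (pderiv k p) * pderiv j (y k) * y i +
          if i = k then aeval y p * pderiv j (y i) else 0 := by
      intro k
      rw [pderiv_mul, pderiv_X, Pi.single_apply]
      by_cases h : i = k
      · subst h; simp; ring
      · simp [h]; ring
    simp only [this, Finset.sum_add_distrib, Finset.sum_ite_eq, Finset.mem_univ, if_true]

theorem jacobian_aeval (y w : Fin n → MvPolynomial (Fin n) F) :
    jacobian (fun i => aeval y (w i)) = aeval y (jacobian w) * jacobian y := by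
  rw [jacobian, jacobian, jacobian, AlgHom.map_det, ← Matrix.det_mul]
  congr 1
  ext1 i j
  simp only [Matrix.mul_apply, Matrix.of_apply, pderiv_aeval, AlgHom.mapMatrix_apply,
    Matrix.map_apply]

theorem jacobian_X : jacobian (X : Fin n → MvPolynomial (Fin n) F) = 1 := by
  rw [jacobian, ← Matrix.det_one (n := Fin n)]
  congr 1
  ext1 i j
  simp [Matrix.one_apply, pderiv_X, Pi.single_apply]

theorem jacobian_update (i : Fin n) (N : MvPolynomial (Fin n) F) :
    jacobian (Function.update X i N) = pderiv i N := by
  have : (Matrix.of fun k j => pderiv j (Function.update (X : Fin n → MvPolynomial (Fin n) F) i N k))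
      = ((1 : Matrix (Fin n) (Fin n) (MvPolynomial (Fin n) F)).updateCol i
          fun j => pderiv j N).transpose := by
    ext1 k j
    by_cases h : k = i
    · subst h; simp
    · simp [h, Matrix.one_apply, pderiv_X, Pi.single_apply, eq_comm]
  rw [jacobian, this, Matrix.det_transpose, ← Matrix.cramer_apply, Matrix.cramer_one]
  rfl

/-- By the chain rule the Jacobian of an invertible substitution is a unit, hence a constant. -/
theorem exists_jacobian_eq_C {u w : Fin n → MvPolynomial (Fin n) F}
    (h : ∀ i, aeval u (w i) = X i) : ∃ c : F, c ≠ 0 ∧ jacobian u = C c := by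
  have h1 : aeval u (jacobian w) * jacobian u = 1 := by
    rw [← jacobian_aeval, funext h, jacobian_X]
  have h2 : IsUnit (jacobian u) := IsUnit.of_mul_eq_one_right _ h1
  obtain ⟨c, hc, h3⟩ := MvPolynomial.isUnit_iff_eq_C_of_isReduced.1 h2
  exact ⟨c, hc.ne_zero, h3⟩

/-- Each family is a polynomial substitution in the other; independence of `f` makes the two
substitutions compose to the identity. -/
theorem exists_jacobian_eq_C_mul {f f' : Fin n → MvPolynomial (Fin n) F}
    (hf : AlgebraicIndependent F f)
    (h : Algebra.adjoin F (Set.range f) = Algebra.adjoin F (Set.range f')) :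
    ∃ c : F, c ≠ 0 ∧ jacobian f' = C c * jacobian f := by
  have h1 : ∀ i, ∃ p, aeval f p = f' i := fun i => by
    have : f' i ∈ (aeval (R := F) f).range := by
      rw [← Algebra.adjoin_range_eq_range_aeval, h]
      exact Algebra.subset_adjoin ⟨i, rfl⟩
    exact this
  have h2 : ∀ i, ∃ p, aeval f' p = f i := fun i => by
    have : f i ∈ (aeval (R := F) f').range := by
      rw [← Algebra.adjoin_range_eq_range_aeval, ← h]
      exact Algebra.subset_adjoin ⟨i, rfl⟩
    exact this
  choose P hP using h1
  choose Q hQ using h2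
  obtain ⟨c, hc, hJ⟩ := exists_jacobian_eq_C (u := P) (w := Q) fun i => by
    apply hf
    rw [aeval_X, ← AlgHom.comp_apply, comp_aeval, funext hP, hQ]
  refine ⟨c, hc, ?_⟩
  rw [← funext hP, jacobian_aeval, hJ, aeval_C, algebraMap_eq]

theorem isHomogeneous_jacobian {f : Fin n → MvPolynomial (Fin n) F} {d : Fin n → ℕ}
    (h : ∀ i, (f i).IsHomogeneous (d i)) : (jacobian f).IsHomogeneous (∑ i, (d i - 1)) := by
  rw [jacobian, ← Matrix.det_transpose, Matrix.det_apply]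
  refine IsHomogeneous.sum _ _ _ fun τ _ => ?_
  rw [Units.smul_def, zsmul_eq_mul, ← map_intCast (C (σ := Fin n) (R := F))]
  refine (IsHomogeneous.prod _ _ _ fun i _ => ?_).C_mul _
  simpa using (h i).pderiv

end Jacobian

/-! ### The finite field generated by a root of unity -/

/-- The field generated by a root of unity `ζ` over the prime field of characteristic `p`. -/
theorem exists_finite_subfield {F : Type*} [Field F] (p : ℕ) [Fact p.Prime] [CharP F p] (ζ : F)
    {e : ℕ} (he : 0 < e) (hζ : ζ ^ e = 1) :
    ∃ (Q : Finset F) (k : ℕ), Q.card = p ^ k ∧ 1 < Q.card ∧ (∀ a ∈ Q, a ^ Q.card = a) ∧ ζ ∈ Q ∧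
      ∀ P : AddSubgroup F, (∀ k, ζ ^ k ∈ P) → ∀ a ∈ Q, a ∈ P := by
  classical
  let _ : Algebra (ZMod p) F := ZMod.algebra F p
  have hint : IsIntegral (ZMod p) ζ := ⟨Polynomial.X ^ e - 1,
    Polynomial.monic_X_pow_sub_C 1 he.ne', by simp [hζ]⟩
  let K := IntermediateField.adjoin (ZMod p) {ζ}
  have : FiniteDimensional (ZMod p) K := IntermediateField.adjoin.finiteDimensional hint
  have : Finite K := Module.finite_of_finite (ZMod p)
  have : Fintype K := Fintype.ofFinite K
  have hfin : (K : Set F).Finite := Set.toFinite _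
  have hcard : hfin.toFinset.card = Fintype.card K := by
    rw [← Nat.card_eq_card_finite_toFinset hfin, Nat.card_eq_fintype_card]; rfl
  refine ⟨hfin.toFinset, Module.finrank (ZMod p) K, ?_, ?_, ?_, ?_, ?_⟩
  · rw [hcard, Module.card_eq_pow_finrank (K := ZMod p), ZMod.card]
  · rw [hcard]; exact Fintype.one_lt_card
  · intro a ha
    rw [hcard]
    have h := FiniteField.pow_card (⟨a, by simpa using ha⟩ : K)
    exact congrArg Subtype.val h
  · simpa using IntermediateField.mem_adjoin_simple_self (ZMod p) ζ
  · intro P hP a ha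
    -- As `ζ` is algebraic, the field is the ring `𝔽_p[ζ]`, whose elements are sums of integer
    -- multiples of powers of `ζ`.
    have ha' : a ∈ Algebra.adjoin (ZMod p) {ζ} := by
      rw [← IntermediateField.adjoin_simple_toSubalgebra_of_isAlgebraic hint.isAlgebraic]
      simpa using ha
    rw [Algebra.adjoin_singleton_eq_range_aeval] at ha'
    obtain ⟨g, rfl⟩ := ha'
    change Polynomial.aeval ζ g ∈ P
    rw [Polynomial.aeval_eq_sum_range]
    refine P.sum_mem fun i _ => ?_
    rw [← ZMod.natCast_zmod_val (g.coeff i), Nat.cast_smul_eq_nsmul]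
    exact P.nsmul_mem (hP i) _

/-! ### Translations of one variable and their invariants -/

section Pivot

variable {F : Type*} [Field F] {σ : Type*} [DecidableEq σ]

/-- The translations `X i ↦ X i + a * (c * X i₀ ^ d)` of one variable. -/
noncomputable def translation (i i₀ : σ) (c : F) (d : ℕ) (a : F) :
    MvPolynomial σ F →ₐ[F] MvPolynomial σ F :=
  aeval (Function.update X i (X i + C a * (C c * X i₀ ^ d)))

theorem translation_add {i i₀ : σ} (hi : i₀ ≠ i) (c : F) (d : ℕ) (a b : F)
    (p : MvPolynomial σ F) :
    translation i i₀ c d (a + b) p = translation i i₀ c d a (translation i i₀ c d b p) := by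
  suffices h : translation (F := F) i i₀ c d (a + b) =
      (translation i i₀ c d a).comp (translation i i₀ c d b) from DFunLike.congr_fun h p
  apply MvPolynomial.algHom_ext
  intro j
  by_cases h : j = i
  · subst h
    simp only [translation, aeval_X, Function.update_self, AlgHom.comp_apply, map_add, map_mul,
      map_pow, Function.update_of_ne hi, algHom_C, algebraMap_eq]
    ring
  · simp [translation, h]

theorem translation_zero (i i₀ : σ) (c : F) (d : ℕ) (p : MvPolynomial σ F) :
    translation i i₀ c d 0 p = p := by
  simp [translation]

/-- The parameters of the translations which fix `p`. -/
noncomputable def periods {i i₀ : σ} (hi : i₀ ≠ i) (c : F) (d : ℕ) (p : MvPolynomial σ F) :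
    AddSubgroup F where
  carrier := {a | translation i i₀ c d a p = p}
  add_mem' {a b} ha hb := by
    rw [Set.mem_ofPred_eq] at *
    rw [translation_add hi, hb, ha]
  zero_mem' := translation_zero i i₀ c d p
  neg_mem' {a} ha := by
    rw [Set.mem_ofPred_eq] at *
    conv_lhs => rw [← ha, ← translation_add hi, neg_add_cancel, translation_zero]

/-- The polynomial `∏ (X i + a * (c * X i₀ ^ d))`, where `a` ranges over the field with
`q` elements. -/
noncomputable def orbitProduct (i i₀ : σ) (c : F) (d q : ℕ) : MvPolynomial σ F :=
  X i ^ q - (C c * X i₀ ^ d) ^ (q - 1) * X i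

theorem toPivot_orbitProduct {i i₀ : σ} (hi : i₀ ≠ i) (c : F) (d q : ℕ) :
    toPivot F i (orbitProduct i i₀ c d q) =
      Polynomial.X ^ q - Polynomial.C ((C c * X ⟨i₀, hi⟩ ^ d) ^ (q - 1)) * Polynomial.X := by
  simp [orbitProduct, toPivot_X_of_ne hi]

theorem monic_X_pow_sub_C_mul_X {A : Type*} [CommRing A] (b : A) {q : ℕ} (hq : 1 < q) :
    (Polynomial.X ^ q - Polynomial.C b * Polynomial.X).Monic :=
  Polynomial.monic_X_pow_sub ((Polynomial.degree_C_mul_X_le b).trans_lt (by exact_mod_cast hq))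

theorem natDegree_X_pow_sub_C_mul_X {A : Type*} [CommRing A] [Nontrivial A] (b : A) {q : ℕ}
    (hq : 1 < q) :
    (Polynomial.X ^ q - Polynomial.C b * Polynomial.X).natDegree = q := by
  rw [Polynomial.natDegree_sub_eq_left_of_natDegree_lt, Polynomial.natDegree_X_pow]
  rw [Polynomial.natDegree_X_pow]
  exact (Polynomial.natDegree_C_mul_le _ _).trans_lt (by rwa [Polynomial.natDegree_X])

theorem aeval_update_orbitProduct_injective {i i₀ : σ} (hi : i₀ ≠ i) (c : F) (d : ℕ) {q : ℕ}
    (hq : 1 < q) : Function.Injective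
      (aeval (R := F) (Function.update (X : σ → MvPolynomial σ F) i (orbitProduct i i₀ c d q))) := by
  apply aeval_update_injective
  rw [toPivot_orbitProduct hi, natDegree_X_pow_sub_C_mul_X _ hq]
  omega

/-- With `β = c * X i₀ ^ d ≠ 0`, the shifts `a * β` for `a ∈ Q` are `q` distinct ones. They fix `X ^
q - β ^ (q - 1) * X`, which is additive and vanishes at each of them because `a ^ q = a`. -/
theorem mem_range_of_translation_invariant {p k : ℕ} [Fact p.Prime] [CharP F p] {i i₀ : σ}
    (hi : i₀ ≠ i) {c : F} (hc : c ≠ 0) (d : ℕ) {Q : Finset F} (hQ : Q.card = p ^ k)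
    (hQ1 : 1 < Q.card) (hQa : ∀ a ∈ Q, a ^ Q.card = a) {f : MvPolynomial σ F}
    (hf : ∀ a ∈ Q, translation i i₀ c d a f = f) :
    f ∈ (aeval (R := F) (Function.update (X : σ → MvPolynomial σ F) i
      (orbitProduct i i₀ c d Q.card))).range := by
  classical
  apply mem_range_aeval_update
  rw [toPivot_orbitProduct hi]
  set β : MvPolynomial {j // j ≠ i} F := C c * X ⟨i₀, hi⟩ ^ d with hβ
  have hβ0 : β ≠ 0 := mul_ne_zero (by simpa using hc) (pow_ne_zero _ (X_ne_zero _))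
  have hinj : Function.Injective fun a : F => (C a * β : MvPolynomial {j // j ≠ i} F) :=
    fun a b h => C_injective _ _ (mul_right_cancel₀ hβ0 h)
  have hcard : (Q.image fun a => C a * β).card = Q.card := Finset.card_image_of_injective _ hinj
  refine exists_eq_comp_of_translation_invariant (Q.image fun a => C a * β) (by omega) _
    (monic_X_pow_sub_C_mul_X _ hQ1) (by rw [natDegree_X_pow_sub_C_mul_X _ hQ1, hcard]) ?_ _ ?_
  · intro b hb
    obtain ⟨a, ha, rfl⟩ := Finset.mem_image.1 hb
    have h1 : (Polynomial.X + Polynomial.C (C a * β)) ^ Q.card =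
        Polynomial.X ^ Q.card + Polynomial.C (C a * β ^ Q.card) := by
      rw [hQ, add_pow_char_pow, ← Polynomial.C_pow, mul_pow, ← C_pow, ← hQ, hQa a ha]
    have h2 : β ^ Q.card = β ^ (Q.card - 1) * β := by
      rw [← pow_succ, Nat.sub_add_cancel hQ1.le]
    rw [Polynomial.sub_comp, Polynomial.mul_comp, Polynomial.X_pow_comp, Polynomial.C_comp,
      Polynomial.X_comp, h1, h2]
    simp only [Polynomial.C_mul]
    ring
  · intro b hb
    obtain ⟨a, ha, rfl⟩ := Finset.mem_image.1 hb
    conv_rhs => rw [← hf a ha, translation, toPivot_aeval_update]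
    simp [toPivot_X_of_ne hi, hβ]

theorem mem_range_of_scaling_invariant {i : σ} {ζ : F} (he : orderOf ζ ≠ 0)
    {f : MvPolynomial σ F} (hf : aeval (Function.update X i (C ζ * X i)) f = f) :
    f ∈ (aeval (R := F) (Function.update (X : σ → MvPolynomial σ F) i
      (X i ^ orderOf ζ))).range := by
  apply mem_range_aeval_update
  have ho : orderOf (C ζ : MvPolynomial {j // j ≠ i} F) = orderOf ζ :=
    orderOf_injective (C : F →+* MvPolynomial {j // j ≠ i} F).toMonoidHom (C_injective _ _) ζ
  have := exists_eq_comp_of_scaling_invariant (C ζ : MvPolynomial {j // j ≠ i} F)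
    (toPivot F i f) (by
      conv_rhs => rw [← hf, toPivot_aeval_update]
      simp) (by rwa [ho])
  simpa [ho] using this

theorem aeval_update_X_pow_injective (i : σ) {e : ℕ} (he : e ≠ 0) : Function.Injective
    (aeval (R := F) (Function.update (X : σ → MvPolynomial σ F) i (X i ^ e))) := by
  apply aeval_update_injective
  simpa using he

end Pivot

/-! ### Adapted coordinates and the orbit step -/

section Adapted

variable {F : Type*} [Field F] {n : ℕ} {Γ : Type*} [Group Γ]

theorem translation_orbitProduct {p k : ℕ} [Fact p.Prime] [CharP F p] {i i₀ : Fin n}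
    (hi : i₀ ≠ i) (c : F) (d : ℕ) {a : F} (hk : 1 ≤ p ^ k) (ha : a ^ p ^ k = a) :
    translation i i₀ c d a (orbitProduct i i₀ c d (p ^ k)) = orbitProduct i i₀ c d (p ^ k) := by
  have h1 : (X i + C a * (C c * X i₀ ^ d) : MvPolynomial (Fin n) F) ^ p ^ k =
      X i ^ p ^ k + C a * (C c * X i₀ ^ d) ^ p ^ k := by
    rw [add_pow_char_pow, mul_pow (C a), ← C_pow, ha]
  have h2 : (C c * X i₀ ^ d : MvPolynomial (Fin n) F) ^ p ^ k =
      (C c * X i₀ ^ d) ^ (p ^ k - 1) * (C c * X i₀ ^ d) := by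
    rw [← pow_succ, Nat.sub_add_cancel hk]
  simp only [translation, orbitProduct, map_sub, map_mul, map_pow, aeval_X, Function.update_self,
    Function.update_of_ne hi, algHom_C, algebraMap_eq]
  rw [h1, h2]
  ring

theorem translation_aeval_update {p k : ℕ} [Fact p.Prime] [CharP F p] {i i₀ : Fin n}
    (hi : i₀ ≠ i) (c : F) (d : ℕ) {a : F} (hk : 1 ≤ p ^ k) (ha : a ^ p ^ k = a)
    (f : MvPolynomial (Fin n) F) :
    translation i i₀ c d a
        (aeval (Function.update X i (orbitProduct i i₀ c d (p ^ k))) f) =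
      aeval (Function.update X i (orbitProduct i i₀ c d (p ^ k))) f := by
  suffices H : (translation i i₀ c d a).comp
      (aeval (R := F) (Function.update X i (orbitProduct i i₀ c d (p ^ k)))) =
      aeval (Function.update X i (orbitProduct i i₀ c d (p ^ k))) from DFunLike.congr_fun H f
  apply MvPolynomial.algHom_ext
  intro j
  rw [AlgHom.comp_apply, aeval_X]
  by_cases hj : j = i
  · subst hj
    rw [Function.update_self]
    exact translation_orbitProduct hi c d hk ha
  · rw [Function.update_of_ne hj]
    simp [translation, hj]

/-- Homogeneous polynomials `y`, one of which is the linear form `L`, which generate the ring of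
invariants of a set `K` of transformations fixing `L`, such that every transformation fixing `L`
translates `y i` by a multiple of `L ^ d i`, and `s` fixes the `y i` other than `L`. -/
structure IsAdapted (ρ : Γ →* (MvPolynomial (Fin n) F →ₐ[F] MvPolynomial (Fin n) F)) (s : Γ)
    (ζ : F) (i₀ : Fin n) (L : MvPolynomial (Fin n) F) (K : Set Γ)
    (y : Fin n → MvPolynomial (Fin n) F) (d : Fin n → ℕ) : Prop where
  fixes : ∀ t ∈ K, ρ t L = L
  homogeneous : ∀ i, (y i).IsHomogeneous (d i)
  injective : Function.Injective (aeval (R := F) y)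
  mem_range_iff : ∀ f, f ∈ (aeval (R := F) y).range ↔ ∀ t ∈ K, ρ t f = f
  eq_form : y i₀ = L
  degree_form : d i₀ = 1
  fixed : ∀ i, i ≠ i₀ → ρ s (y i) = y i
  translates : ∀ t, ρ t L = L → ∀ i, ∃ c, ρ t (y i) = y i + C c * L ^ d i
  -- Ensures that `s` scales `L ^ d i` by `ζ` itself, whatever the degree.
  root_pow : ∀ i, ζ ^ d i = ζ
  jacobian_eq : ∃ c m, c ≠ 0 ∧ jacobian y = C c * L ^ m

variable {ρ : Γ →* (MvPolynomial (Fin n) F →ₐ[F] MvPolynomial (Fin n) F)} {s : Γ}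
  {ζ : F} {i₀ : Fin n} {L : MvPolynomial (Fin n) F} {K : Set Γ}
  {y : Fin n → MvPolynomial (Fin n) F} {d : Fin n → ℕ}

theorem IsAdapted.homogeneous_form (hA : IsAdapted ρ s ζ i₀ L K y d) : L.IsHomogeneous 1 := by
  have := hA.homogeneous i₀
  rwa [hA.eq_form, hA.degree_form] at this

theorem IsAdapted.form_ne_zero (hA : IsAdapted ρ s ζ i₀ L K y d) : L ≠ 0 := by
  rw [← hA.eq_form]
  intro h
  have : aeval y (X i₀ : MvPolynomial (Fin n) F) = aeval y (0 : MvPolynomial (Fin n) F) := by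
    rw [aeval_X, h, map_zero]
  exact X_ne_zero _ (hA.injective this)

theorem aeval_comp_apply (y w : Fin n → MvPolynomial (Fin n) F) (p : MvPolynomial (Fin n) F) :
    aeval (fun i => aeval y (w i)) p = aeval y (aeval w p) := by
  rw [← AlgHom.comp_apply, comp_aeval]

/-- Polynomials which generate the whole polynomial ring when substituted in each other. -/
theorem aeval_aeval_eq_self {u w : Fin n → MvPolynomial (Fin n) F}
    (h : ∀ i, aeval u (w i) = X i) (p : MvPolynomial (Fin n) F) : aeval u (aeval w p) = p := by
  rw [← aeval_comp_apply, funext h, aeval_X_left_apply]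

/-- The coordinates `y j` may be changed by multiples of `L ^ (d j - d i) * y i`. -/
theorem IsAdapted.shear (hA : IsAdapted ρ s ζ i₀ L K y d) (hζ : ζ ≠ 0)
    (hs : ρ s L = C ζ * L) {i : Fin n} (hi : i ≠ i₀) (b : Fin n → F) (hbi : b i = 0)
    (hb₀ : b i₀ = 0) (hb : ∀ j, b j ≠ 0 → d i ≤ d j) :
    IsAdapted ρ s ζ i₀ L K (fun j => y j - C (b j) * (L ^ (d j - d i) * y i)) d := by
  set w : Fin n → MvPolynomial (Fin n) F :=
    fun j => X j - C (b j) * (X i₀ ^ (d j - d i) * X i) with hw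
  set w' : Fin n → MvPolynomial (Fin n) F :=
    fun j => X j + C (b j) * (X i₀ ^ (d j - d i) * X i) with hw'
  have hyw : (fun j => y j - C (b j) * (L ^ (d j - d i) * y i)) = fun j => aeval y (w j) := by
    funext j
    simp [hw, hA.eq_form, algebraMap_eq]
  -- The two shears are mutually inverse because they leave both `X i` and `X i₀` alone.
  have h1 : ∀ j, aeval w (w' j) = X j := fun j => by
    simp [hw, hw', hbi, hb₀, algebraMap_eq]
  have h2 : ∀ j, aeval w' (w j) = X j := fun j => by
    simp [hw, hw', hbi, hb₀, algebraMap_eq]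
  constructor
  · exact hA.fixes
  · intro j
    by_cases hj : b j = 0
    · simpa [hj] using hA.homogeneous j
    · refine (hA.homogeneous j).sub (IsHomogeneous.C_mul ?_ _)
      have := (hA.homogeneous_form.pow (d j - d i)).mul (hA.homogeneous i)
      rwa [one_mul, Nat.sub_add_cancel (hb j hj)] at this
  · rw [hyw]
    intro p q hpq
    rw [aeval_comp_apply, aeval_comp_apply] at hpq
    rw [← aeval_aeval_eq_self h2 p, hA.injective hpq, aeval_aeval_eq_self h2]
  · intro f
    rw [← hA.mem_range_iff, hyw]
    constructor
    · rintro ⟨p, rfl⟩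
      exact ⟨aeval w p, (aeval_comp_apply y w p).symm⟩
    · rintro ⟨p, rfl⟩
      refine ⟨aeval w' p, ?_⟩
      change aeval (fun j => aeval y (w j)) (aeval w' p) = aeval y p
      rw [aeval_comp_apply, aeval_aeval_eq_self h1]
  · simp [hb₀, hA.eq_form]
  · exact hA.degree_form
  · intro j hj
    by_cases hbj : b j = 0
    · simpa [hbj] using hA.fixed j hj
    -- Both degrees satisfy `ζ ^ d = ζ`, so `s` fixes `L ^ (d j - d i)`.
    · have h3 : ζ ^ (d j - d i) = 1 := by
        have h4 : ζ ^ (d j - d i) * ζ = ζ := by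
          conv_lhs => enter [2]; rw [← hA.root_pow i]
          rw [← pow_add, Nat.sub_add_cancel (hb j hbj), hA.root_pow]
        exact mul_right_cancel₀ hζ (h4.trans (one_mul _).symm)
      rw [map_sub, map_mul, map_mul, map_pow, hs, algHom_C, hA.fixed j hj, hA.fixed i hi,
        mul_pow, ← C_pow, h3, C_1, one_mul, algebraMap_eq]
  · intro t ht j
    obtain ⟨cj, hcj⟩ := hA.translates t ht j
    obtain ⟨ci, hci⟩ := hA.translates t ht i
    refine ⟨cj - b j * ci, ?_⟩
    rw [map_sub, map_mul, map_mul, map_pow, ht, algHom_C, hcj, hci, algebraMap_eq]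
    by_cases hbj : b j = 0
    · simp [hbj]
    · rw [C_sub, C_mul]
      conv_rhs => rw [← Nat.sub_add_cancel (hb j hbj), pow_add]
      conv_lhs => rw [← Nat.sub_add_cancel (hb j hbj), pow_add]
      rw [Nat.add_sub_cancel]
      ring
  · exact hA.root_pow
  · obtain ⟨c, m, hc, hJ⟩ := hA.jacobian_eq
    obtain ⟨c', hc', hJ'⟩ := exists_jacobian_eq_C h1
    exact ⟨c' * c, m, mul_ne_zero hc' hc, by
      rw [hyw, jacobian_aeval, hJ', hJ, aeval_C, algebraMap_eq, C_mul, mul_assoc]⟩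

theorem map_conj_apply {f : MvPolynomial (Fin n) F} (h t : Γ) :
    ρ (t * h * t⁻¹) f = ρ t (ρ h (ρ t⁻¹ f)) := by
  rw [map_mul, map_mul]; rfl

theorem map_inv_apply_of_eq {f g : MvPolynomial (Fin n) F} {t : Γ} (h : ρ t f = g) :
    ρ t⁻¹ g = f := by
  rw [← h, ← AlgHom.mul_apply, ← map_mul, inv_mul_cancel, map_one, AlgHom.one_apply]

theorem map_pow_apply_form (hs : ρ s L = C ζ * L) (k : ℕ) : ρ (s ^ k) L = C (ζ ^ k) * L := by
  induction k with
  | zero => simp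
  | succ k ih =>
    rw [pow_succ, map_mul, AlgHom.mul_apply, hs, map_mul, ih, algHom_C, algebraMap_eq, pow_succ,
      C_mul]
    ring

theorem map_pow_apply_of_eq {f : MvPolynomial (Fin n) F} (h : ρ s f = f) (k : ℕ) :
    ρ (s ^ k) f = f := by
  induction k with
  | zero => simp
  | succ k ih => rw [pow_succ, map_mul, AlgHom.mul_apply, h, ih]

theorem map_conj_apply_form (hζ : ζ ≠ 0) (hs : ρ s L = C ζ * L) {h : Γ} (hh : ρ h L = L)
    (k : ℕ) : ρ (s ^ k * h * (s ^ k)⁻¹) L = L := by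
  have h1 : ρ (s ^ k)⁻¹ L = C ((ζ ^ k)⁻¹) * L := by
    apply map_inv_apply_of_eq
    rw [map_mul, map_pow_apply_form hs, algHom_C, algebraMap_eq, ← mul_assoc, ← C_mul,
      inv_mul_cancel₀ (pow_ne_zero _ hζ), C_1, one_mul]
  rw [map_conj_apply, h1, map_mul, hh, map_mul, map_pow_apply_form hs, algHom_C, algebraMap_eq,
    algHom_C, algebraMap_eq, ← mul_assoc, ← C_mul, inv_mul_cancel₀ (pow_ne_zero _ hζ), C_1, one_mul]

/-- On `y i`: `s ^ k` and its inverse fix it, `h` adds `c * L ^ d i`, and `s ^ k` scales that term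
by `ζ ^ (k * d i) = ζ ^ k`. -/
theorem IsAdapted.map_conj_aeval (hA : IsAdapted ρ s ζ i₀ L K y d) (hζ0 : ζ ≠ 0)
    (hs : ρ s L = C ζ * L) {i : Fin n} (hi : i ≠ i₀) {c : F} {h : Γ} (hh : ρ h L = L)
    (hfix : ∀ j, j ≠ i → ρ h (y j) = y j) (hmove : ρ h (y i) = y i + C c * L ^ d i) (k : ℕ)
    (f : MvPolynomial (Fin n) F) :
    ρ (s ^ k * h * (s ^ k)⁻¹) (aeval y f) = aeval y (translation i i₀ c (d i) (ζ ^ k) f) := by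
  suffices H : (ρ (s ^ k * h * (s ^ k)⁻¹)).comp (aeval (R := F) y) =
      (aeval y).comp (translation i i₀ c (d i) (ζ ^ k)) from DFunLike.congr_fun H f
  apply MvPolynomial.algHom_ext
  intro j
  by_cases hj0 : j = i₀
  · subst hj0
    rw [AlgHom.comp_apply, aeval_X, hA.eq_form, map_conj_apply_form hζ0 hs hh]
    simp [translation, Function.update_of_ne hi.symm, hA.eq_form]
  have h1 : ρ (s ^ k) (y j) = y j := map_pow_apply_of_eq (hA.fixed j hj0) k
  rw [AlgHom.comp_apply, aeval_X, map_conj_apply, map_inv_apply_of_eq h1]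
  by_cases hj : j = i
  · subst hj
    rw [hmove, map_add, h1, map_mul, map_pow (ρ (s ^ k)), map_pow_apply_form hs, mul_pow, ← C_pow,
      ← pow_mul, mul_comm k, pow_mul, hA.root_pow]
    simp [translation, hA.eq_form, algebraMap_eq]
    ring
  · rw [hfix j hj, h1]
    simp [translation, hj]

set_option maxHeartbeats 800000 in
/-- If `h` moves only the coordinate `y i`, then replacing `y i` by its orbit product gives
coordinates for the invariants under the conjugates of `h` by the powers of `s`. -/
theorem IsAdapted.orbitStep (hA : IsAdapted ρ s ζ i₀ L K y d) {e : ℕ} (he : 0 < e)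
    (hζ : ζ ^ e = 1) (hs : ρ s L = C ζ * L) {p : ℕ} [Fact p.Prime] [CharP F p]
    {i : Fin n} (hi : i ≠ i₀) {c : F} (hc : c ≠ 0) {h : Γ} (hh : ρ h L = L)
    (hfix : ∀ j, j ≠ i → ρ h (y j) = y j) (hmove : ρ h (y i) = y i + C c * L ^ d i) :
    ∃ y' d', IsAdapted ρ s ζ i₀ L (K ∪ Set.range fun k : ℕ => s ^ k * h * (s ^ k)⁻¹) y' d' := by
  have hζ0 : ζ ≠ 0 := by rintro rfl; simp [he.ne'] at hζ
  obtain ⟨Q, k, hQ, hQ1, hQa, hζQ, hgen⟩ := exists_finite_subfield p ζ he hζ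
  have hk : k ≠ 0 := by rintro rfl; simp [hQ] at hQ1
  have hζq : ζ ^ (Q.card - 1) = 1 := by
    apply mul_right_cancel₀ hζ0
    rw [← pow_succ, Nat.sub_add_cancel hQ1.le, one_mul, hQa ζ hζQ]
  set w : Fin n → MvPolynomial (Fin n) F :=
    Function.update X i (orbitProduct i i₀ c (d i) Q.card) with hw
  have hwi : w i = orbitProduct i i₀ c (d i) Q.card := Function.update_self ..
  have hwj : ∀ j, j ≠ i → w j = X j := fun j hj => Function.update_of_ne hj ..
  have hyi : aeval y (w i) = y i ^ Q.card - (C c * L ^ d i) ^ (Q.card - 1) * y i := by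
    simp [hwi, orbitProduct, hA.eq_form, algebraMap_eq]
  have hyj : ∀ j, j ≠ i → aeval y (w j) = y j := fun j hj => by rw [hwj j hj, aeval_X]
  have hconj := hA.map_conj_aeval hζ0 hs hi hh hfix hmove
  refine ⟨fun j => aeval y (w j), Function.update d i (d i * Q.card), ?_⟩
  constructor
  · rintro t (ht | ⟨k, rfl⟩)
    · exact hA.fixes t ht
    · exact map_conj_apply_form hζ0 hs hh k
  · intro j
    by_cases hj : j = i
    · subst hj
      simp only [hyi, Function.update_self]
      refine ((hA.homogeneous j).pow _).sub ?_
      have := (((hA.homogeneous_form.pow (d j)).C_mul c).pow (Q.card - 1)).mul (hA.homogeneous j)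
      rwa [one_mul, ← Nat.mul_succ, Nat.succ_eq_add_one, Nat.sub_add_cancel hQ1.le] at this
    · simp only [hyj j hj, Function.update_of_ne hj]
      exact hA.homogeneous j
  · intro p q hpq
    rw [aeval_comp_apply, aeval_comp_apply] at hpq
    exact aeval_update_orbitProduct_injective hi.symm c (d i) hQ1 (hA.injective hpq)
  · intro f
    constructor
    · rintro ⟨p, rfl⟩ t (ht | ⟨k, rfl⟩)
      · exact (hA.mem_range_iff _).1 ⟨aeval w p, (aeval_comp_apply y w p).symm⟩ t ht
      · change ρ _ (aeval (fun j => aeval y (w j)) p) = aeval (fun j => aeval y (w j)) p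
        rw [aeval_comp_apply, hconj, hw, hQ, translation_aeval_update hi.symm c (d i) (hQ ▸ hQ1.le)
          (by rw [← hQ, ← pow_mul, mul_comm, pow_mul, hQa ζ hζQ])]
    · intro hf
      obtain ⟨p, rfl⟩ := (hA.mem_range_iff f).2 fun t ht => hf t (Or.inl ht)
      -- The periods of `p` form an additive group. Invariance under the conjugates puts every `ζ ^
      -- k` in it, hence all of `Q`.
      have hp : ∀ a ∈ Q, translation i i₀ c (d i) a p = p := by
        refine hgen (periods hi.symm c (d i) p) fun k => hA.injective ?_
        rw [← hconj]
        exact hf _ (Or.inr ⟨k, rfl⟩)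
      obtain ⟨g, rfl⟩ := mem_range_of_translation_invariant hi.symm hc (d i) hQ hQ1 hQa hp
      exact ⟨g, aeval_comp_apply y w g⟩
  · simp only [hyj i₀ hi.symm, hA.eq_form]
  · rw [Function.update_of_ne hi.symm, hA.degree_form]
  · intro j hj
    by_cases hji : j = i
    · subst hji
      rw [hyi, map_sub, map_mul, map_pow, map_pow, map_mul, map_pow, hA.fixed j hj, hs, algHom_C,
        algebraMap_eq, mul_pow (C ζ), ← C_pow, hA.root_pow, mul_left_comm, mul_pow (C ζ),
        ← C_pow, hζq, C_1, one_mul]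
    · rw [hyj j hji, hA.fixed j hj]
  · intro t ht j
    obtain ⟨a, ha⟩ := hA.translates t ht j
    by_cases hj : j = i
    · subst hj
      -- The orbit product is additive in `y j`, so the new translation is its value at the old one.
      refine ⟨a ^ Q.card - c ^ (Q.card - 1) * a, ?_⟩
      rw [hyi, map_sub, map_mul, map_pow, map_pow, map_mul, map_pow, ha, ht, algHom_C,
        algebraMap_eq, Function.update_self]
      have h1 : (y j + C a * L ^ d j) ^ Q.card =
          y j ^ Q.card + C (a ^ Q.card) * L ^ (d j * Q.card) := by
        rw [hQ, add_pow_char_pow, mul_pow, ← C_pow, ← pow_mul]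
      have h2 : L ^ (d j * Q.card) = (L ^ d j) ^ (Q.card - 1) * L ^ d j := by
        rw [← pow_succ, Nat.sub_add_cancel hQ1.le, pow_mul]
      rw [h1, C_sub, sub_mul, C_mul, h2, C_pow c, mul_pow]
      ring
    · exact ⟨a, by rw [hyj j hj, ha, Function.update_of_ne hj]⟩
  · intro j
    by_cases hj : j = i
    · subst hj
      rw [Function.update_self, pow_mul, hA.root_pow, hQa ζ hζQ]
    · rw [Function.update_of_ne hj, hA.root_pow]
  · obtain ⟨b, m, hb, hJ⟩ := hA.jacobian_eq
    refine ⟨-c ^ (Q.card - 1) * b, d i * (Q.card - 1) + m,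
      mul_ne_zero (neg_ne_zero.2 (pow_ne_zero _ hc)) hb, ?_⟩
    -- Since `q = 0` in `F`, only the linear term of the orbit product contributes to the
    -- derivative.
    have hq0 : ((Q.card : ℕ) : MvPolynomial (Fin n) F) = 0 := by
      rw [hQ, Nat.cast_pow, CharP.cast_eq_zero, zero_pow hk]
    have h1 : jacobian w = - (C c * X i₀ ^ d i) ^ (Q.card - 1) := by
      rw [hw, jacobian_update, orbitProduct, map_sub, pderiv_pow, hq0, pderiv_mul, mul_pow,
        ← C_pow, ← pow_mul, pderiv_C_mul, pderiv_pow, pderiv_X_of_ne hi.symm, pderiv_X_self]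
      ring
    rw [jacobian_aeval, h1, hJ]
    simp only [map_neg, map_pow, map_mul, aeval_C, aeval_X, hA.eq_form, algebraMap_eq,
      pow_add, pow_mul]
    ring

end Adapted

/-! ### From linear coordinates to basic invariants -/

section Reduction

variable {F : Type*} [Field F] {n : ℕ} {Γ : Type*} [Group Γ]
  {ρ : Γ →* (MvPolynomial (Fin n) F →ₐ[F] MvPolynomial (Fin n) F)} {s : Γ}
  {ζ : F} {i₀ : Fin n} {L : MvPolynomial (Fin n) F} {K : Set Γ}
  {y : Fin n → MvPolynomial (Fin n) F} {d : Fin n → ℕ}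

theorem map_aeval_of_fixed {φ : MvPolynomial (Fin n) F →ₐ[F] MvPolynomial (Fin n) F}
    (h : ∀ j, φ (y j) = y j) (p : MvPolynomial (Fin n) F) : φ (aeval y p) = aeval y p := by
  suffices H : φ.comp (aeval (R := F) y) = aeval y from DFunLike.congr_fun H p
  apply MvPolynomial.algHom_ext
  intro j
  rw [AlgHom.comp_apply, aeval_X, h]

theorem C_mul_form_injective (hL : L ≠ 0) {a b : F} (h : C a * L = C b * L) : a = b :=
  C_injective _ _ (mul_right_cancel₀ hL h)

theorem map_pow_translate {h : Γ} (hh : ρ h L = L) {f : MvPolynomial (Fin n) F} {c : F} {m : ℕ}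
    (hf : ρ h f = f + C c * L ^ m) (k : ℕ) : ρ (h ^ k) f = f + C (k * c) * L ^ m := by
  induction k with
  | zero => simp
  | succ k ih =>
    rw [pow_succ', map_mul, AlgHom.mul_apply, ih, map_add, hf, map_mul, map_pow, hh, algHom_C,
      algebraMap_eq, Nat.cast_succ, add_mul, C_add, one_mul]
    ring

/-- If `h` fixes all coordinates, nothing changes. Otherwise a moved coordinate of least degree
serves as pivot: a shear with ratios `c j / c i` stops `h` from moving the others, and the orbit
step applies. -/
theorem IsAdapted.exists_insert (hA : IsAdapted ρ s ζ i₀ L K y d) {e : ℕ} (he : 0 < e)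
    (hζ : ζ ^ e = 1) (hs : ρ s L = C ζ * L) {h : Γ} (hh : ρ h L = L) (hfin : IsOfFinOrder h) :
    ∃ K' y' d', K ⊆ K' ∧ h ∈ K' ∧ IsAdapted ρ s ζ i₀ L K' y' d' := by
  choose c hc using hA.translates h hh
  by_cases hc0 : ∀ j, c j = 0
  · have hfix : ∀ j, ρ h (y j) = y j := fun j => by rw [hc, hc0]; simp
    refine ⟨insert h K, y, d, Set.subset_insert _ _, Set.mem_insert _ _,
      { hA with fixes := ?_, mem_range_iff := ?_ }⟩
    · rintro t (rfl | ht)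
      · exact hh
      · exact hA.fixes t ht
    · intro f
      constructor
      · rintro hf t (rfl | ht)
        · obtain ⟨p, rfl⟩ := hf
          exact map_aeval_of_fixed hfix p
        · exact (hA.mem_range_iff f).1 hf t ht
      · exact fun hf => (hA.mem_range_iff f).2 fun t ht => hf t (Or.inr ht)
  · classical
    push Not at hc0
    obtain ⟨j₁, hj₁⟩ := hc0
    obtain ⟨i, hi, hmin⟩ := Finset.exists_min_image (Finset.univ.filter fun j => c j ≠ 0) d
      ⟨j₁, by simpa using hj₁⟩
    have hci : c i ≠ 0 := by simpa using hi
    have hL := hA.form_ne_zero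
    have hi₀ : c i₀ = 0 := by
      have h1 := hc i₀
      rw [hA.eq_form, hh, left_eq_add, mul_eq_zero] at h1
      simpa using h1.resolve_right (pow_ne_zero _ hL)
    have hne : i ≠ i₀ := by rintro rfl; exact hci hi₀
    have hζ0 : ζ ≠ 0 := by rintro rfl; simp [he.ne'] at hζ
    obtain ⟨N, hN, hhN⟩ := isOfFinOrder_iff_pow_eq_one.1 hfin
    -- Finite order of a nontrivial translation forces positive characteristic.
    have hNc : (N : F) * c i = 0 := by
      have h1 := map_pow_translate hh (hc i) N
      rw [hhN, map_one, AlgHom.one_apply, left_eq_add, mul_eq_zero] at h1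
      exact C_eq_zero.1 (h1.resolve_right (pow_ne_zero _ hL))
    rcases CharP.exists' F with h0 | ⟨p, hp, hpF⟩
    · exact absurd hNc (mul_ne_zero (Nat.cast_ne_zero.2 hN.ne') hci)
    · have hA' := hA.shear hζ0 hs hne (fun j => if j = i then 0 else c j / c i) (by simp)
        (by simp [hi₀]) fun j hj => hmin j (by
          simp only [ne_eq, ite_eq_left_iff, not_forall] at hj
          obtain ⟨-, h1⟩ := hj
          simp only [Finset.mem_filter, Finset.mem_univ, true_and]
          rintro h2
          simp [h2] at h1)
      obtain ⟨y', d', h'⟩ := hA'.orbitStep he hζ hs hne hci hh (fun j hj => by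
          simp only [hj, if_false]
          by_cases hcj : c j = 0
          · have := hc j
            rw [hcj] at this
            simpa [hcj] using this
          · have hd : d i ≤ d j := hmin j (by simpa using hcj)
            have h1 : L ^ d j = L ^ (d j - d i) * L ^ d i := by
              rw [← pow_add, Nat.sub_add_cancel hd]
            have h2 : C (c j) = C (c j / c i) * (C (c i) : MvPolynomial (Fin n) F) := by
              rw [← C_mul, div_mul_cancel₀ _ hci]
            rw [map_sub, map_mul, map_mul, map_pow, hh, algHom_C, algebraMap_eq, hc, hc, h1, h2]
            ring) (by simpa using hc i)
      refine ⟨_, y', d', Set.subset_union_left, ?_, h'⟩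
      -- `h` is its own conjugate by `s ^ 0`.
      exact Set.mem_union_right _ ⟨0, by simp⟩

theorem IsAdapted.exists_stabilizer [Finite Γ] (hA : IsAdapted ρ s ζ i₀ L K y d) {e : ℕ}
    (he : 0 < e) (hζ : ζ ^ e = 1) (hs : ρ s L = C ζ * L) :
    ∃ K' y' d', (∀ t, ρ t L = L → t ∈ K') ∧ IsAdapted ρ s ζ i₀ L K' y' d' := by
  classical
  suffices H : ∀ S : Finset Γ, ∃ K' y' d', (∀ t ∈ S, ρ t L = L → t ∈ K') ∧
      IsAdapted ρ s ζ i₀ L K' y' d' by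
    have := Fintype.ofFinite Γ
    simpa using H Finset.univ
  intro S
  induction S using Finset.induction_on with
  | empty => exact ⟨K, y, d, by simp, hA⟩
  | insert h S _ ih =>
    obtain ⟨K', y', d', hK', hA'⟩ := ih
    by_cases hh : ρ h L = L
    · obtain ⟨K'', y'', d'', hle, hmem, hA''⟩ :=
        hA'.exists_insert he hζ hs hh (isOfFinOrder_of_finite h)
      refine ⟨K'', y'', d'', fun t ht htL => ?_, hA''⟩
      rcases Finset.mem_insert.1 ht with rfl | ht
      · exact hmem
      · exact hle (hK' t ht htL)
    · refine ⟨K', y', d', fun t ht htL => ?_, hA'⟩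
      rcases Finset.mem_insert.1 ht with rfl | ht
      · exact absurd htL hh
      · exact hK' t ht htL

/-- A field containing a primitive `e`-th root of unity has characteristic prime to `e`; this keeps
the derivative of `X ^ e` nonzero. -/
theorem natCast_orderOf_ne_zero (he : orderOf ζ ≠ 0) : (orderOf ζ : F) ≠ 0 := by
  have := NeZero.mk he
  exact ((IsPrimitiveRoot.orderOf ζ).neZero').out

/-- From coordinates for the invariants under the stabilizer of `L` to basic invariants of the
whole group, generated by the stabilizer and `s`. -/
theorem IsAdapted.exists_generators (hA : IsAdapted ρ s ζ i₀ L K y d) (he : orderOf ζ ≠ 0)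
    (hs : ρ s L = C ζ * L) (hK : ∀ t, ρ t L = L → t ∈ K)
    (hgen : ∀ g, ∃ (k : ℕ) (t : Γ), ρ t L = L ∧ g = s ^ k * t) :
    ∃ f : Fin n → MvPolynomial (Fin n) F, (∀ i, ∃ d, (f i).IsHomogeneous d) ∧
      AlgebraicIndependent F f ∧ (∀ p, p ∈ (aeval (R := F) f).range ↔ ∀ g, ρ g p = p) ∧
      ∃ c m, c ≠ 0 ∧ jacobian f = C c * L ^ m := by
  set e := orderOf ζ with hedef
  set w : Fin n → MvPolynomial (Fin n) F := Function.update X i₀ (X i₀ ^ e) with hw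
  have hwi : aeval (R := F) y (w i₀) = L ^ e := by
    rw [hw, Function.update_self, map_pow, aeval_X, hA.eq_form]
  have hwj : ∀ j, j ≠ i₀ → aeval (R := F) y (w j) = y j := fun j hj => by
    rw [hw, Function.update_of_ne hj, aeval_X]
  have hζe : ζ ^ e = 1 := pow_orderOf_eq_one ζ
  have hfixw : ∀ j, ρ s (aeval (R := F) y (w j)) = aeval (R := F) y (w j) := fun j => by
    by_cases hj : j = i₀
    · subst hj
      rw [hwi, map_pow, hs, mul_pow, ← C_pow, hζe, C_1, one_mul]
    · rw [hwj j hj, hA.fixed j hj]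
  have hsy : ∀ p : MvPolynomial (Fin n) F, ρ s (aeval y p) =
      aeval y (aeval (R := F) (Function.update X i₀ (C ζ * X i₀)) p) := by
    intro p
    suffices H : (ρ s).comp (aeval (R := F) y) =
        (aeval y).comp (aeval (R := F) (Function.update X i₀ (C ζ * X i₀))) from DFunLike.congr_fun H p
    apply MvPolynomial.algHom_ext
    intro j
    by_cases hj : j = i₀
    · subst hj
      simp [hA.eq_form, hs, algebraMap_eq]
    · simp [hj, hA.fixed j hj]
  refine ⟨fun j => aeval y (w j), ?_, ?_, ?_, ?_⟩
  · intro j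
    by_cases hj : j = i₀
    · subst hj
      exact ⟨1 * e, by dsimp only; rw [hwi]; exact hA.homogeneous_form.pow e⟩
    · exact ⟨d j, by dsimp only; rw [hwj j hj]; exact hA.homogeneous j⟩
  · intro p q hpq
    rw [aeval_comp_apply, aeval_comp_apply] at hpq
    exact aeval_update_X_pow_injective i₀ he (hA.injective hpq)
  · intro p
    constructor
    · rintro ⟨q, rfl⟩ g
      obtain ⟨k, t, ht, rfl⟩ := hgen g
      change ρ _ (aeval (fun j => aeval y (w j)) q) = aeval (fun j => aeval y (w j)) q
      have h1 : ρ t (aeval (fun j => aeval y (w j)) q) = aeval (fun j => aeval y (w j)) q :=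
        (hA.mem_range_iff _).1 ⟨aeval w q, (aeval_comp_apply y w q).symm⟩ t (hK t ht)
      rw [map_mul, AlgHom.mul_apply, h1]
      exact map_pow_apply_of_eq (map_aeval_of_fixed hfixw q) k
    · intro hp
      obtain ⟨q, rfl⟩ := (hA.mem_range_iff p).2 fun t _ => hp t
      have hq := hA.injective ((hsy q).symm.trans (hp s))
      obtain ⟨r, rfl⟩ := mem_range_of_scaling_invariant he hq
      exact ⟨r, aeval_comp_apply y w r⟩
  · obtain ⟨b, m, hb, hJ⟩ := hA.jacobian_eq
    refine ⟨(e : F) * b, e - 1 + m, mul_ne_zero (natCast_orderOf_ne_zero he) hb, ?_⟩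
    rw [jacobian_aeval, hw, jacobian_update, pderiv_pow, pderiv_X_self, hJ, map_mul, map_mul,
      map_pow, map_natCast, aeval_X, hA.eq_form, map_one, pow_add, C_mul, map_natCast]
    ring

theorem exists_linear_adapted {a : Fin n → F} (ha : a i₀ ≠ 0) (hLa : L = ∑ j, C (a j) * X j)
    (hX : ∀ g j, ∃ c, ρ g (X j) = X j + C c * L) (hs : ρ s L = C ζ * L)
    (hs1 : ζ = 1 → s = 1) :
    ∃ y, IsAdapted ρ s ζ i₀ L ∅ y fun _ => 1 := by
  classical
  choose c hc using hX s
  -- Solves `c j + b j * ζ = b j`, so that `s` fixes `X j + b j * L`. If `ζ = 1`, division by zero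
  -- gives `b = 0`, and `s = 1` fixes everything.
  set b : Fin n → F := fun j => c j / (1 - ζ) with hb
  set y : Fin n → MvPolynomial (Fin n) F :=
    Function.update (fun j => X j + C (b j) * L) i₀ L with hy
  have hyi : y i₀ = L := Function.update_self ..
  have hyj : ∀ j, j ≠ i₀ → y j = X j + C (b j) * L := fun j hj => Function.update_of_ne hj ..
  have hL1 : L.IsHomogeneous 1 := by
    rw [hLa]
    exact IsHomogeneous.sum _ _ _ fun j _ => (isHomogeneous_X F j).C_mul (a j)
  -- The inverse substitution, recovering `X i₀` from `L = ∑ a j * X j` by dividing by `a i₀`.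
  set v : Fin n → MvPolynomial (Fin n) F := Function.update (fun j => X j - C (b j) * X i₀) i₀
    (C (a i₀)⁻¹ * (X i₀ - ∑ j ∈ Finset.univ.erase i₀, C (a j) * (X j - C (b j) * X i₀))) with hv
  have hvj : ∀ j, j ≠ i₀ → aeval y (X j - C (b j) * X i₀) = X j := fun j hj => by
    simp [hyi, hyj j hj, algebraMap_eq]
  have hyv : ∀ j, aeval y (v j) = X j := fun j => by
    by_cases hj : j = i₀
    · subst hj
      rw [hv, Function.update_self, map_mul, map_sub, map_sum, aeval_X, hyi, algHom_C]
      have h1 : ∑ k ∈ Finset.univ.erase j, aeval y (C (a k) * (X k - C (b k) * X j)) =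
          ∑ k ∈ Finset.univ.erase j, C (a k) * X k := by
        refine Finset.sum_congr rfl fun k hk => ?_
        rw [map_mul, hvj k (Finset.ne_of_mem_erase hk), algHom_C, algebraMap_eq]
      rw [h1, hLa, ← Finset.add_sum_erase _ _ (Finset.mem_univ j), add_sub_cancel_right,
        algebraMap_eq, ← mul_assoc, ← C_mul, inv_mul_cancel₀ ha, C_1, one_mul]
    · rw [hv, Function.update_of_ne hj, hvj j hj]
  have hvi : aeval v L = X i₀ := by
    have h1 : ∑ k ∈ Finset.univ.erase i₀, aeval v (C (a k) * X k) =
        ∑ k ∈ Finset.univ.erase i₀, C (a k) * (X k - C (b k) * X i₀) := by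
      refine Finset.sum_congr rfl fun k hk => ?_
      rw [map_mul, algHom_C, aeval_X, hv, Function.update_of_ne (Finset.ne_of_mem_erase hk),
        algebraMap_eq]
    rw [hLa, map_sum, ← Finset.add_sum_erase _ _ (Finset.mem_univ i₀), h1, map_mul, algHom_C,
      aeval_X, hv, Function.update_self, algebraMap_eq, ← mul_assoc, ← C_mul, mul_inv_cancel₀ ha,
      C_1, one_mul, sub_add_cancel]
  have hvy : ∀ j, aeval v (y j) = X j := fun j => by
    by_cases hj : j = i₀
    · rw [hj, hyi, hvi]
    · rw [hyj j hj, map_add, map_mul, hvi, algHom_C, aeval_X, hv, Function.update_of_ne hj,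
        algebraMap_eq, sub_add_cancel]
  have hsurj : Function.Surjective (aeval (R := F) y) :=
    fun p => ⟨aeval v p, aeval_aeval_eq_self hyv p⟩
  refine ⟨y, ?_⟩
  constructor
  · simp
  · intro j
    by_cases hj : j = i₀
    · rw [hj, hyi]; exact hL1
    · rw [hyj j hj]; exact (isHomogeneous_X F j).add (hL1.C_mul _)
  · exact Function.LeftInverse.injective (aeval_aeval_eq_self hvy)
  · exact fun f => ⟨fun _ t ht => absurd ht (Set.notMem_empty t), fun _ => hsurj f⟩
  · exact hyi
  · rfl
  · intro j hj
    by_cases hζ : ζ = 1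
    · rw [hs1 hζ, map_one, AlgHom.one_apply]
    · have h1 : c j + b j * ζ = b j := by
        have : 1 - ζ ≠ 0 := sub_ne_zero.2 (Ne.symm hζ)
        rw [hb]; field_simp; ring
      rw [hyj j hj, map_add, map_mul, hs, hc, algHom_C, algebraMap_eq]
      conv_rhs => rw [← h1, C_add, C_mul]
      ring
  · intro t ht j
    obtain ⟨ct, hct⟩ := hX t j
    by_cases hj : j = i₀
    · exact ⟨0, by rw [hj, hyi, ht]; simp⟩
    · refine ⟨ct, ?_⟩
      rw [hyj j hj, map_add, map_mul, ht, hct, algHom_C, algebraMap_eq]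
      ring
  · exact fun _ => pow_one ζ
  · obtain ⟨c', hc', hJ⟩ := exists_jacobian_eq_C hyv
    exact ⟨c', 0, hc', by rw [hJ, pow_zero, mul_one]⟩

/-- A finite group of substitutions which moves all variables by multiples of one linear form has
a polynomial ring of invariants, and the Jacobian is a power of that form up to a constant. -/
theorem exists_generators_of_translations [Finite Γ] {a : Fin n → F} (ha : a i₀ ≠ 0)
    (hLa : L = ∑ j, C (a j) * X j) (hX : ∀ g j, ∃ c, ρ g (X j) = X j + C c * L) :
    ∃ f : Fin n → MvPolynomial (Fin n) F, (∀ i, ∃ d, (f i).IsHomogeneous d) ∧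
      AlgebraicIndependent F f ∧ (∀ p, p ∈ (aeval (R := F) f).range ↔ ∀ g, ρ g p = p) ∧
      ∃ c m, c ≠ 0 ∧ jacobian f = C c * L ^ m := by
  have hL : L ≠ 0 := by
    intro h
    have h1 := congrArg (coeff (Finsupp.single i₀ 1)) (hLa.symm.trans h)
    classical
    simp [coeff_sum, coeff_C_mul, coeff_X, Finsupp.single_left_inj] at h1
    exact ha h1
  have hχ : ∀ g, ∃ c, ρ g L = C c * L := fun g => by
    choose c hc using hX g
    refine ⟨1 + ∑ j, a j * c j, ?_⟩
    conv_lhs => rw [hLa]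
    rw [map_sum, C_add, add_mul, map_sum, Finset.sum_mul, C_1, one_mul]
    conv_rhs => enter [1]; rw [hLa]
    rw [← Finset.sum_add_distrib]
    refine Finset.sum_congr rfl fun j _ => ?_
    rw [map_mul, algHom_C, hc, algebraMap_eq, C_mul]
    ring
  choose χ' hχ' using hχ
  let χ : Γ →* F :=
    { toFun := χ'
      map_one' := C_mul_form_injective hL (by rw [← hχ', map_one, AlgHom.one_apply, C_1, one_mul])
      map_mul' := fun g h => C_mul_form_injective hL (by
        rw [← hχ', map_mul, AlgHom.mul_apply, hχ', map_mul, hχ', algHom_C, algebraMap_eq, C_mul]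
        ring) }
  have hχL : ∀ g, ρ g L = C (χ g) * L := hχ'
  -- The image of `χ` is a finite subgroup of `Fˣ`, hence cyclic. When it is trivial, `s` must be
  -- chosen as `1`.
  obtain ⟨s, hs1, hsgen⟩ : ∃ s, (χ s = 1 → s = 1) ∧ ∀ g, ∃ k : ℕ, χ g = χ s ^ k := by
    by_cases htriv : ∀ g, χ g = 1
    · exact ⟨1, fun _ => rfl, fun g => ⟨0, by rw [htriv, pow_zero]⟩⟩
    · have : Finite χ.toHomUnits.range := Set.finite_range χ.toHomUnits
      obtain ⟨⟨-, s, rfl⟩, hu⟩ := IsCyclic.exists_monoid_generator (α := χ.toHomUnits.range)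
      have hsk : ∀ g, ∃ k : ℕ, χ g = χ s ^ k := fun g => by
        obtain ⟨k, hk⟩ := hu ⟨χ.toHomUnits g, g, rfl⟩
        refine ⟨k, ?_⟩
        have := congrArg (fun x : χ.toHomUnits.range => ((x : Fˣ) : F)) hk
        simpa using this.symm
      refine ⟨s, fun h => absurd (fun g => ?_) htriv, hsk⟩
      obtain ⟨k, hk⟩ := hsk g
      rw [hk, h, one_pow]
  have hfin : IsOfFinOrder (χ s) := χ.isOfFinOrder (isOfFinOrder_of_finite s)
  have he : 0 < orderOf (χ s) := orderOf_pos_iff.2 hfin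
  obtain ⟨y, hA⟩ := exists_linear_adapted (ρ := ρ) ha hLa hX (hχL s) hs1
  obtain ⟨K', y', d', hK', hA'⟩ := hA.exists_stabilizer he (pow_orderOf_eq_one _) (hχL s)
  refine hA'.exists_generators he.ne' (hχL s) hK' fun g => ?_
  obtain ⟨k, hk⟩ := hsgen g
  refine ⟨k, (s ^ k)⁻¹ * g, ?_, by group⟩
  have h1 : χ ((s ^ k)⁻¹ * g) = 1 := by
    rw [map_mul, hk, ← map_pow, ← map_mul, inv_mul_cancel, map_one]
  rw [hχL, h1, C_1, one_mul]

end Reduction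

/-! ### The action of `GL(V)` on polynomials -/

section Action

variable {F V : Type*} [Field F] [AddCommGroup V] [Module F V] {n : ℕ}
  (z : Module.Basis (Fin n) F (Module.Dual F V))

theorem linForm_self (j : Fin n) : linForm z (z j) = X j := by
  classical
  simp [linForm, Finsupp.single_apply, Finset.sum_ite_eq]

theorem linForm_add_smul (ξ η : Module.Dual F V) (c : F) :
    linForm z (ξ + c • η) = linForm z ξ + C c * linForm z η := by
  simp only [linForm, map_add, map_smul, Finsupp.add_apply, Finsupp.smul_apply, smul_eq_mul,
    C_mul, Finset.mul_sum, ← Finset.sum_add_distrib]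
  exact Finset.sum_congr rfl fun j _ => by ring

theorem linForm_comp (ξ : Module.Dual F V) (φ : V →ₗ[F] V) :
    linForm z (ξ.comp φ) = ∑ j, C (z.repr ξ j) * linForm z ((z j).comp φ) := by
  have h : ξ.comp φ = ∑ j, z.repr ξ j • (z j).comp φ := by
    ext v
    conv_lhs => rw [← z.sum_repr ξ]
    simp only [LinearMap.comp_apply, LinearMap.sum_apply, LinearMap.smul_apply]
  conv_lhs => rw [h, linForm]
  simp only [linForm, map_sum, map_smul, Finsupp.finsetSum_apply, Finsupp.smul_apply,
    smul_eq_mul, C_mul, Finset.sum_mul, Finset.mul_sum]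
  rw [Finset.sum_comm]
  exact Finset.sum_congr rfl fun j _ => Finset.sum_congr rfl fun k _ => by ring

theorem act_linForm (g : LinearMap.GeneralLinearGroup F V) (ξ : Module.Dual F V) :
    act z g (linForm z ξ) =
      linForm z (ξ.comp ((g⁻¹ : LinearMap.GeneralLinearGroup F V) : V →ₗ[F] V)) := by
  rw [linForm_comp, act, linForm, map_sum]
  simp [algebraMap_eq]

theorem act_X (g : LinearMap.GeneralLinearGroup F V) (j : Fin n) :
    act z g (X j) =
      linForm z ((z j).comp ((g⁻¹ : LinearMap.GeneralLinearGroup F V) : V →ₗ[F] V)) := by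
  rw [act, aeval_X]

/-- The action on the polynomial ring as a homomorphism of monoids. -/
noncomputable def actHom :
    LinearMap.GeneralLinearGroup F V →* (MvPolynomial (Fin n) F →ₐ[F] MvPolynomial (Fin n) F) where
  toFun := act z
  map_one' := by
    apply MvPolynomial.algHom_ext
    intro j
    rw [act_X, inv_one, AlgHom.one_apply]
    exact linForm_self z j
  map_mul' g h := by
    apply MvPolynomial.algHom_ext
    intro j
    rw [AlgHom.mul_apply, act_X, act_X, act_linForm, mul_inv_rev]
    rfl

theorem exists_eq_add_smul_of_ker {l ξ η : Module.Dual F V} (hl : l ≠ 0)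
    (h : ∀ v, l v = 0 → η v = ξ v) : ∃ c : F, η = ξ + c • l := by
  obtain ⟨v₀, hv₀⟩ := DFunLike.ne_iff.1 hl
  rw [LinearMap.zero_apply] at hv₀
  refine ⟨(η v₀ - ξ v₀) / l v₀, LinearMap.ext fun v => ?_⟩
  -- Subtracting this multiple of `v₀` moves `v` into the kernel of `l`.
  have h1 := h (v - (l v / l v₀) • v₀) (by simp [hv₀])
  simp only [map_sub, map_smul, smul_eq_mul] at h1
  simp only [LinearMap.add_apply, LinearMap.smul_apply, smul_eq_mul]
  linear_combination h1

/-- The nonzero Jacobian is homogeneous of degree `∑ (d i - 1)`, and `C c * L ^ m` of degree `m`. -/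
theorem exponentSum_eq {f : Fin n → MvPolynomial (Fin n) F}
    (hhom : ∀ i, ∃ d, (f i).IsHomogeneous d) (hind : AlgebraicIndependent F f)
    {L : MvPolynomial (Fin n) F} (hL : L.IsHomogeneous 1) (hL0 : L ≠ 0) {c : F} (hc : c ≠ 0)
    {m : ℕ} (hJ : jacobian f = C c * L ^ m) : exponentSum f = m := by
  choose d hd using hhom
  have h1 := isHomogeneous_jacobian hd
  have h2 : exponentSum f = ∑ i, (d i - 1) :=
    Finset.sum_congr rfl fun i _ => by rw [(hd i).totalDegree (hind.ne_zero i)]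
  rw [hJ] at h1
  have h3 := ((hL.pow m).C_mul c).inj_right h1
    (mul_ne_zero (by simpa using hc) (pow_ne_zero _ hL0))
  rw [h2, ← h3, one_mul]

end Action

end HyperplaneInvariants

/-! ### The main theorem -/

theorem proposition2p3 {F V : Type*} [Field F] [AddCommGroup V] [Module F V]
    [FiniteDimensional F V] {n : ℕ} (z : Module.Basis (Fin n) F (Module.Dual F V))
    (H : Submodule F V) (hH : IsCoatom H)
    (l : Module.Dual F V) (hl : LinearMap.ker l = H)
    (G : Subgroup (LinearMap.GeneralLinearGroup F V)) [Finite G]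
    (hG : ∀ g ∈ G, ∀ v ∈ H, (g : V →ₗ[F] V) v = v) :
    HyperplaneInvariants.HasPolynomialInvariants z G ∧
    ∀ f : Fin n → MvPolynomial (Fin n) F, HyperplaneInvariants.IsBasicInvariants z G f →
      ∃ c : F, c ≠ 0 ∧
        HyperplaneInvariants.jacobian f =
          MvPolynomial.C c *
            HyperplaneInvariants.linForm z l ^ HyperplaneInvariants.exponentSum f := by
  open HyperplaneInvariants MvPolynomial in
  have hl0 : l ≠ 0 := by
    rintro rfl
    exact hH.1 (by rw [← hl, LinearMap.ker_zero])
  obtain ⟨i₀, hi₀⟩ : ∃ i, z.repr l i ≠ 0 := by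
    by_contra! h
    exact hl0 (z.repr.map_eq_zero_iff.1 (Finsupp.ext h))
  -- `g⁻¹` also fixes `H` pointwise, so `z j ∘ g⁻¹` and `z j` agree on the kernel of `l`.
  have hX : ∀ (g : G) (j : Fin n), ∃ c,
      ((actHom z).comp G.subtype) g (X j) = X j + C c * linForm z l := by
    intro g j
    obtain ⟨c, hc⟩ := exists_eq_add_smul_of_ker (ξ := z j)
      (η := (z j).comp (((g : LinearMap.GeneralLinearGroup F V)⁻¹ :
        LinearMap.GeneralLinearGroup F V) : V →ₗ[F] V)) hl0 fun v hv => by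
        have hvH : v ∈ H := by rwa [← hl, LinearMap.mem_ker]
        rw [LinearMap.comp_apply, hG _ (G.inv_mem g.2) v hvH]
    refine ⟨c, ?_⟩
    change act z g (X j) = _
    rw [act_X, hc, linForm_add_smul, linForm_self]
  obtain ⟨f, hhom, hind, hrange, c, m, hc, hJ⟩ := exists_generators_of_translations
    (ρ := (actHom z).comp G.subtype) (a := fun j => z.repr l j) hi₀ rfl hX
  have hadj : Algebra.adjoin F (Set.range f) = invariants z G := by
    rw [Algebra.adjoin_range_eq_range_aeval]
    ext p
    exact (hrange p).trans ⟨fun h g hg => h ⟨g, hg⟩, fun h g => h g g.2⟩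
  refine ⟨⟨f, hhom, hind, hadj⟩, fun f' hf' => ?_⟩
  obtain ⟨c', hc', hJ'⟩ := exists_jacobian_eq_C_mul hind (hadj.trans hf'.adjoin_eq.symm)
  have hJ'' : jacobian f' = C (c' * c) * linForm z l ^ m := by
    rw [hJ', hJ, C_mul, mul_assoc, linForm]
  have hL1 : (linForm z l).IsHomogeneous 1 :=
    IsHomogeneous.sum _ _ _ fun j _ => (isHomogeneous_X F j).C_mul _
  have hL0 : linForm z l ≠ 0 := by
    intro h
    have h1 := congrArg (coeff (Finsupp.single i₀ 1)) h
    classical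
    simp [linForm, coeff_sum, coeff_C_mul, coeff_X, Finsupp.single_left_inj] at h1
    exact hi₀ h1
  refine ⟨c' * c, mul_ne_zero hc' hc, ?_⟩
  rw [exponentSum_eq hf'.homogeneous hf'.algebraicIndependent hL1 hL0 (mul_ne_zero hc' hc) hJ'',
    hJ'']
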